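/- Let $\mathcal P=(\mathcal P,d,\mu)$ be a metric space with a Borel regular measure $\mu$ such that every ball has finite positive measure and $\mu$ is doubling: there is $c_{\mathrm{dbl}}\ge 1$ with $\mu(B(x,2r))\le c_{\mathrm{dbl}}\,\mu(B(x,r))$ for all $x\in\mathcal P$, $r>0$. Balls are open, and $\lambda B=B(x,\lambda r)$ for $B=B(x,r)$. Let $\mathcal M$ be the set of all $\mu$-measurable functions $\mathcal P\to[-\infty,\infty]$. A Borel function $g:\mathcal P\to[0,\infty]$ is an upper gradient of $u:\mathcal P\to[-\infty,\infty]$ if $|u(\gamma(0))-u(\gamma(l))|\le\int_0^{l} g(\gamma(t))\,dt$ for every non-constant rectifiable curve $\gamma:[0,l]\to\mathcal P$ parametrized by arc length, where $|(\pm\infty)-(\pm\infty)|=\infty$. Let $p\in[1,\infty)$ and assume that $\mathcal P$ supports a $p$-Poincaré inequality: there are $c>0$ and $\lambda\ge1$ such that for all balls $B$, all $u\in\mathcal M$ that are integrable on every ball, and all upper gradients $g$ of $u$, $$\frac1{\mu(B)}\int_B|u-u_B|\,d\mu\le c\,\operatorname{diam}(B)\Bigl(\frac1{\mu(\lambda B)}\int_{\lambda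 B}g^p\,d\mu\Bigr)^{1/p},\qquad u_B=\frac1{\mu(B)}\int_B u\,d\mu .$$ Let $X=\{u\in\mathcal M:\|u\|_X<\infty\}$ be a quasi-Banach function lattice, i.e. $\|\cdot\|_X:\mathcal M\to[0,\infty]$ satisfies, for some constant $C\ge1$ and all $u,v,u_n\in\mathcal M$, $a\in\mathbb R$: $\|u\|_X=0$ if and only if $u=0$ a.e.; $\|au\|_X=|a|\|u\|_X$; $\|u+v\|_X\le C(\|u\|_X+\|v\|_X)$; $\|u\|_X\le\|v\|_X$ whenever $|u|\le|v|$ a.e.; $\bigl\|\sum_{n=1}^\infty u_n\bigr\|_X\le\sum_{n=1}^\infty C^n\|u_n\|_X$ whenever $u_n\ge0$ a.e. for all $n$; and $\|u_n\|_X\to\|u\|_X$ whenever $\|u_n-u\|_X\to0$. Assume that the quasi-norm is absolutely continuous: for every $u\in X$, $\|u\chi_{E_n}\|_X\to0$ for every decreasing sequence of measurable sets $E_n$ with $\mu\bigl(\bigcap_n E_n\bigr)=0$. Let $M_pv(x)=\sup_{B\ni x}\bigl(\frac1{\mu(B)}\int_B|v|^p\,d\mu\bigr)^{1/p}$, the supremum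 being over all balls $B$ that contain $x$, and assume that $$\bigl\|\sigma\,\chi_{\{x\in\mathcal P:\,M_pv(x)>\sigma\}}\bigr\|_X\to0\quad\text{as }\sigma\to\infty,\qquad\text{for every }v\in X.$$ For $u\in\mathcal M$ let $\|u\|_{N^1X}=\|u\|_X+\inf_g\|g\|_X$, the infimum being over all upper gradients $g$ of $u$, and let $N^1X=\{u\in\mathcal M:\|u\|_{N^1X}<\infty\}$. Then Lipschitz functions are dense in $N^1X$: for every $u\in N^1X$ and $\varepsilon>0$ there is a Lipschitz function $f:\mathcal P\to\mathbb R$ with $f\in N^1X$ and $\|u-f\|_{N^1X}<\varepsilon$. -/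

import Mathlib

open MeasureTheory Filter Topology
open scoped ENNReal NNReal

noncomputable section

/-- A quasi-Banach function lattice `X` over `(P, μ)`, given by its quasi-norm, a `[0, ∞]`-valued
functional on the extended real-valued `μ`-measurable functions (for a measure on the Borel
`σ`-algebra, being measurable with respect to the completion of `μ` is `AEMeasurable`). The values of
`qnorm` on other functions are irrelevant. The space itself is the set of measurable functions with
finite quasi-norm, see `QuasiBanachFunctionLattice.Mem`. -/
structure QuasiBanachFunctionLattice {P : Type*} [MeasurableSpace P] (μ : Measure P) where
  /-- the quasi-norm -/
  qnorm : (P → EReal) → ℝ≥0∞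
  /-- the modulus of concavity -/
  modulus : ℝ≥0
  one_le_modulus : 1 ≤ modulus
  qnorm_eq_zero_iff : ∀ u : P → EReal, AEMeasurable u μ → (qnorm u = 0 ↔ u =ᵐ[μ] 0)
  qnorm_smul : ∀ (a : ℝ) (u : P → EReal), AEMeasurable u μ →
    qnorm (fun x => (a : EReal) * u x) = ENNReal.ofReal |a| * qnorm u
  qnorm_add_le : ∀ u v : P → EReal, AEMeasurable u μ → AEMeasurable v μ →
    qnorm (fun x => u x + v x) ≤ modulus * (qnorm u + qnorm v)
  /-- lattice property -/
  qnorm_mono : ∀ u v : P → EReal, AEMeasurable u μ → AEMeasurable v μ →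
    (∀ᵐ x ∂μ, (u x).abs ≤ (v x).abs) → qnorm u ≤ qnorm v
  /-- Riesz--Fischer property; the sequence is indexed from `0`, so that the `n`-th weight is
  `modulus ^ (n + 1)` -/
  qnorm_tsum_le : ∀ u : ℕ → P → ℝ≥0∞, (∀ n, AEMeasurable (u n) μ) →
    qnorm (fun x => ((∑' n, u n x : ℝ≥0∞) : EReal)) ≤
      ∑' n, (modulus : ℝ≥0∞) ^ (n + 1) * qnorm (fun x => (u n x : EReal))
  /-- continuity of the quasi-norm -/
  qnorm_continuous : ∀ (u : ℕ → P → EReal) (v : P → EReal), (∀ n, AEMeasurable (u n) μ) →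
    AEMeasurable v μ → Tendsto (fun n => qnorm (fun x => u n x - v x)) atTop (𝓝 0) →
    Tendsto (fun n => qnorm (u n)) atTop (𝓝 (qnorm v))

namespace QuasiBanachFunctionLattice

variable {P : Type*} [MeasurableSpace P] {μ : Measure P}

/-- Membership of an (everywhere defined) function in the space `X`. -/
def Mem (X : QuasiBanachFunctionLattice μ) (u : P → EReal) : Prop :=
  AEMeasurable u μ ∧ X.qnorm u < ∞

/-- Absolute continuity of the quasi-norm of `X`. -/
def AbsolutelyContinuous (X : QuasiBanachFunctionLattice μ) : Prop :=
  ∀ u : P → EReal, X.Mem u → ∀ E : ℕ → Set P, (∀ n, NullMeasurableSet (E n) μ) → Antitone E →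
    μ (⋂ n, E n) = 0 → Tendsto (fun n => X.qnorm ((E n).indicator u)) atTop (𝓝 0)

end QuasiBanachFunctionLattice

/-- `μ` is doubling, and all balls have positive and finite measure. -/
structure IsDoublingMetricMeasure {P : Type*} [MetricSpace P] [MeasurableSpace P]
    (μ : Measure P) : Prop where
  ball_pos : ∀ (x : P) (r : ℝ), 0 < r → 0 < μ (Metric.ball x r)
  ball_lt_top : ∀ (x : P) (r : ℝ), 0 < r → μ (Metric.ball x r) < ∞
  doubling : ∃ c : ℝ≥0, ∀ (x : P) (r : ℝ), 0 < r →
    μ (Metric.ball x (2 * r)) ≤ c * μ (Metric.ball x r)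

/-- `g` is an upper gradient of `u`. Curves are non-constant, rectifiable and parametrized by
arc length, that is, they are the maps `γ : [0, l] → P` of unit speed with `l > 0`.
In `EReal`, `⊤ - ⊤ = ⊥ - ⊥ = ⊥`, so `|(±∞) - (±∞)| = ∞`. -/
def IsUpperGradient {P : Type*} [MetricSpace P] [MeasurableSpace P]
    (g : P → ℝ≥0∞) (u : P → EReal) : Prop :=
  Measurable g ∧ ∀ (l : ℝ) (γ : ℝ → P), 0 < l → HasUnitSpeedOn γ (Set.Icc 0 l) →
    (u (γ 0) - u (γ l)).abs ≤ ∫⁻ t in Set.Icc 0 l, g (γ t)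

/-- `u` is measurable and integrable on every ball. -/
def IsLocallyIntegrable {P : Type*} [MetricSpace P] [MeasurableSpace P]
    (μ : Measure P) (u : P → EReal) : Prop :=
  AEMeasurable u μ ∧ ∀ (x : P) (r : ℝ), 0 < r → ∫⁻ z in Metric.ball x r, (u z).abs ∂μ < ∞

/-- `(P, μ)` supports a `p`-Poincaré inequality (with dilation factor `lam`). -/
def SupportsPoincare {P : Type*} [MetricSpace P] [MeasurableSpace P]
    (μ : Measure P) (p : ℝ) : Prop :=
  ∃ c : ℝ≥0, 0 < c ∧ ∃ lam : ℝ, 1 ≤ lam ∧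
    ∀ (x : P) (r : ℝ), 0 < r → ∀ u : P → EReal, IsLocallyIntegrable μ u →
      ∀ g : P → ℝ≥0∞, IsUpperGradient g u →
        ⨍⁻ z in Metric.ball x r,
            (u z - ((⨍ y in Metric.ball x r, (u y).toReal ∂μ : ℝ) : EReal)).abs ∂μ ≤
          c * Metric.ediam (Metric.ball x r) *
            (⨍⁻ z in Metric.ball x (lam * r), g z ^ p ∂μ) ^ (1 / p)

/-- The non-centered maximal function `M_p u`, the supremum being over all open balls that
contain `x`. -/
def maximalFunction {P : Type*} [MetricSpace P] [MeasurableSpace P]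
    (μ : Measure P) (p : ℝ) (u : P → EReal) (x : P) : ℝ≥0∞ :=
  ⨆ (y : P) (r : ℝ) (_ : 0 < r) (_ : x ∈ Metric.ball y r),
    (⨍⁻ z in Metric.ball y r, (u z).abs ^ p ∂μ) ^ (1 / p)

namespace QuasiBanachFunctionLattice

variable {P : Type*} [MetricSpace P] [MeasurableSpace P] {μ : Measure P}

/-- The Newtonian quasi-seminorm `‖u‖_X + inf_g ‖g‖_X`, the infimum being over all upper gradients
`g` of `u`. -/
def newtonNorm (X : QuasiBanachFunctionLattice μ) (u : P → EReal) : ℝ≥0∞ :=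
  X.qnorm u + ⨅ (g : P → ℝ≥0∞) (_ : IsUpperGradient g u), X.qnorm (fun x => (g x : EReal))

/-- Membership in the Newtonian space `N¹X`. -/
def MemNewton (X : QuasiBanachFunctionLattice μ) (u : P → EReal) : Prop :=
  AEMeasurable u μ ∧ X.newtonNorm u < ∞

end QuasiBanachFunctionLattice

end

/-! The approximation has two stages. Each leaves an error `w` that vanishes off a small Borel set F
and has an upper gradient g + K with K constant. The key is localization
(`IsUpperGradient.indicator_add`): such a `w` also has the upper gradient (g + K)χ_F + δg for every
δ > 0. Along a curve on which g is integrable, `w` is continuous; between its first and last zero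
there is no net change, and the rest of the curve lies in F. So only the size of `w` and of (g +
K)χ_F matters.

Truncation: u minus its truncation at ±n vanishes off {|u| > n}, with K = 0. These sets decrease to
a null set, and absolute continuity of the quasi-norm makes the error tend to 0.

Bounded v, |v| ≤ k: the Poincaré inequality and telescoping over shrinking balls make v Lipschitz
with constant Kn off {M_p g > n} and a null set (`exists_lipschitzOnWith_of_supportsPoincare`).
Extend from there to a Lipschitz function and truncate at ±k to get f. On F the error v - f is at
most 2k, and its localized gradient is gχ_F + Knχ_F + δg. The maximal function hypothesis disposes
of the multiples of nχ_F. It also shows that the sets {M_p g > n} decrease to a null set, so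
absolute continuity disposes of gχ_F. -/

/-! ### Consequences of doubling -/

namespace IsDoublingMetricMeasure

variable {P : Type*} [MetricSpace P] [MeasurableSpace P] {μ : Measure P}

theorem sigmaFinite (hμ : IsDoublingMetricMeasure μ) : SigmaFinite μ := by
  rcases isEmpty_or_nonempty P with h | ⟨⟨x⟩⟩
  · rw [Measure.eq_zero_of_isEmpty μ]
    infer_instance
  · refine ⟨⟨fun n : ℕ => Metric.ball x (n + 1), fun _ => trivial,
      fun n => hμ.ball_lt_top x _ (by positivity), ?_⟩⟩
    refine Set.eq_univ_of_forall fun y => Set.mem_iUnion.2 ?_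
    obtain ⟨n, hn⟩ := exists_nat_gt (dist y x)
    exact ⟨n, by simp only [Metric.mem_ball]; linarith⟩

/-- Balls of radius ε/2 about the points are disjoint and of positive measure; a σ-finite measure
admits only countably many. -/
theorem countable_of_isSeparated [OpensMeasurableSpace P] (hμ : IsDoublingMetricMeasure μ)
    {ε : ℝ} (hε : 0 < ε) {s : Set P} (hs : s.Pairwise fun x y => ε < dist x y) :
    s.Countable := by
  have := hμ.sigmaFinite
  have h := Measure.countable_meas_pos_of_disjoint_iUnion (μ := μ)
    (As := fun x : s => Metric.ball (x : P) (ε / 2)) (fun _ => Metric.isOpen_ball.measurableSet) ?_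
  · have huniv : {i : s | 0 < μ (Metric.ball (i : P) (ε / 2))} = Set.univ :=
      Set.eq_univ_of_forall fun i => hμ.ball_pos _ _ (by positivity)
    rw [huniv, Set.countable_univ_iff] at h
    exact Set.countable_coe_iff.1 h
  · intro x y hxy
    refine Metric.ball_disjoint_ball ?_
    have := hs x.2 y.2 (fun h => hxy (Subtype.ext h))
    linarith

/-- A maximal ε-separated set is countable and ε-dense. Second countability is needed for Lebesgue
differentiation. -/
theorem secondCountableTopology [OpensMeasurableSpace P] (hμ : IsDoublingMetricMeasure μ) :
    SecondCountableTopology P := by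
  refine Metric.secondCountable_of_almost_dense_set fun ε hε => ?_
  obtain ⟨s, hs⟩ := zorn_subset {s : Set P | s.Pairwise fun x y => ε < dist x y} (by
    intro c hc hchain
    refine ⟨⋃₀ c, ?_, fun s hs => Set.subset_sUnion_of_mem hs⟩
    exact (Set.pairwise_sUnion hchain.directedOn).2 hc)
  refine ⟨s, hμ.countable_of_isSeparated hε hs.prop, fun x => ?_⟩
  by_contra! hx
  have hxs : x ∉ s := fun h => absurd (hx x h) (by simp [hε.le])
  refine hxs (hs.le_of_ge (y := insert x s) ?_ (Set.subset_insert x s) (Set.mem_insert x s))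
  refine Set.Pairwise.insert hs.prop fun y hy _ => ⟨hx y hy, ?_⟩
  rw [dist_comm]
  exact hx y hy

theorem isUnifLocDoublingMeasure (hμ : IsDoublingMetricMeasure μ) :
    IsUnifLocDoublingMeasure μ := by
  obtain ⟨c, hc⟩ := hμ.doubling
  -- One factor `c` pays for doubling, the other for passing from closed to open balls.
  refine ⟨⟨c * c, ?_⟩⟩
  filter_upwards [self_mem_nhdsWithin] with ε hε x
  have hε : 0 < ε := hε
  calc μ (Metric.closedBall x (2 * ε)) ≤ μ (Metric.ball x (2 * (2 * ε))) :=
        measure_mono (Metric.closedBall_subset_ball (by linarith))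
    _ ≤ c * μ (Metric.ball x (2 * ε)) := hc x _ (by positivity)
    _ ≤ c * (c * μ (Metric.ball x ε)) := by gcongr; exact hc x _ hε
    _ ≤ c * (c * μ (Metric.closedBall x ε)) := by gcongr; exact Metric.ball_subset_closedBall
    _ = _ := by push_cast; ring

theorem isLocallyFiniteMeasure (hμ : IsDoublingMetricMeasure μ) : IsLocallyFiniteMeasure μ :=
  ⟨fun x => ⟨Metric.ball x 1, Metric.ball_mem_nhds x one_pos, hμ.ball_lt_top x 1 one_pos⟩⟩

end IsDoublingMetricMeasure

/-! ### Averages, the maximal function and Lipschitz estimates -/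

/-- Comparison of averages over nested sets of comparable measure. -/
theorem enorm_setAverage_sub_le {P : Type*} [MeasurableSpace P] {μ : Measure P} {A B : Set P}
    (hAB : A ⊆ B) (hA : 0 < μ A) (hB : μ B ≠ ∞) {c : ℝ≥0∞} (hc : μ B ≤ c * μ A)
    {v : P → ℝ} (hv : IntegrableOn v A μ) (m : ℝ) :
    ‖(⨍ y in A, v y ∂μ) - m‖ₑ ≤ c * ⨍⁻ z in B, ‖v z - m‖ₑ ∂μ := by
  have hA' : μ A < ∞ := (measure_mono hAB).trans_lt hB.lt_top
  have hfin : IsFiniteMeasure (μ.restrict A) := ⟨by simpa using hA'⟩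
  have hA0 : NeZero (μ.restrict A) := ⟨by
    rw [Ne, Measure.restrict_eq_zero]; exact hA.ne'⟩
  have hsub : (⨍ y in A, v y ∂μ) - m = ⨍ y in A, (v y - m) ∂μ := by
    conv_lhs => rw [← average_const (μ.restrict A) m]
    simp only [average_eq]
    rw [integral_sub hv (integrable_const m), smul_sub]
  rw [hsub, setAverage_eq, setLAverage_eq, enorm_smul]
  have h1 : ‖(μ.real A)⁻¹‖ₑ = (μ A)⁻¹ := by
    rw [enorm_inv (by simp [measureReal_def, ENNReal.toReal_eq_zero_iff, hA.ne', hA'.ne]),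
      Real.enorm_of_nonneg measureReal_nonneg, measureReal_def, ENNReal.ofReal_toReal hA'.ne]
  rw [h1]
  have h2 : (μ A)⁻¹ ≤ c * (μ B)⁻¹ := by
    rw [← div_eq_mul_inv, ENNReal.le_div_iff_mul_le (Or.inl (hA.trans_le (measure_mono hAB)).ne')
      (Or.inl hB), mul_comm, ← div_eq_mul_inv]
    exact ENNReal.div_le_of_le_mul hc
  calc (μ A)⁻¹ * ‖∫ y in A, (v y - m) ∂μ‖ₑ
      ≤ (c * (μ B)⁻¹) * ∫⁻ z in B, ‖v z - m‖ₑ ∂μ := by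
        gcongr
        exact (enorm_integral_le_lintegral_enorm _).trans (lintegral_mono_set hAB)
    _ = _ := by rw [div_eq_mul_inv]; ring

theorem integrableOn_of_abs_le {P : Type*} [MeasurableSpace P] {μ : Measure P}
    {v : P → ℝ} (hv : AEMeasurable v μ) {k : ℝ}
    (hk : ∀ x, |v x| ≤ k) {A : Set P} (hA : μ A ≠ ∞) : IntegrableOn v A μ :=
  Measure.integrableOn_of_bounded (M := k) hA hv.aestronglyMeasurable
    (Eventually.of_forall hk)

section Oscillation

variable {P : Type*} [MetricSpace P] [MeasurableSpace P] {μ : Measure P}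

/-- With `1 ≤ c`, a single doubling can be weakened to the factor `c * c`, so one constant serves
all comparisons of balls. -/
theorem exists_one_le_doubling (hμ : IsDoublingMetricMeasure μ) : ∃ c : ℝ≥0, 1 ≤ c ∧
    ∀ (x : P) (r : ℝ), 0 < r → μ (Metric.ball x (2 * r)) ≤ c * μ (Metric.ball x r) := by
  obtain ⟨c, hc⟩ := hμ.doubling
  refine ⟨max c 1, le_max_right _ _, fun x r hr => (hc x r hr).trans ?_⟩
  gcongr
  exact le_max_left _ _

/-- If the means of `v` over `B(x, r)` and over its large subsets differ by at most `L r` for all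
`r`, then at a Lebesgue point `x` the value of `v` is within `2 L r` of its mean over `B(x, r)`. -/
theorem abs_average_ball_sub_le {v : P → ℝ} {x : P} {C : ℝ≥0} {L : ℝ} (hL : 0 ≤ L)
    (hdbl : ∀ r, 0 < r → μ (Metric.ball x (2 * r)) ≤ C * μ (Metric.ball x r))
    (hosc : ∀ r, 0 < r → ∀ A ⊆ Metric.ball x r, μ (Metric.ball x r) ≤ C * μ A →
      |(⨍ y in A, v y ∂μ) - ⨍ y in Metric.ball x r, v y ∂μ| ≤ L * r)
    (hleb : ∀ δ : ℕ → ℝ, Tendsto δ atTop (𝓝[>] 0) →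
      Tendsto (fun n => ⨍ y in Metric.closedBall x (δ n), v y ∂μ) atTop (𝓝 (v x)))
    {r : ℝ} (hr : 0 < r) :
    |v x - ⨍ y in Metric.ball x r, v y ∂μ| ≤ 2 * L * r := by
  -- Halving the radius for the m-th time, m = 0, 1, ..., costs `L * r * (1 / 2) ^ m`; the bound is
  -- the geometric sum.
  have hchain : ∀ n : ℕ, |(⨍ y in Metric.ball x (r * (1 / 2) ^ n), v y ∂μ) -
      ⨍ y in Metric.ball x r, v y ∂μ| ≤ 2 * L * r * (1 - (1 / 2) ^ n) := by
    intro n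
    induction n with
    | zero => simp
    | succ n ih =>
      have hn : 0 < r * (1 / 2) ^ n := by positivity
      have hstep := hosc (r * (1 / 2) ^ n) hn (Metric.ball x (r * (1 / 2) ^ (n + 1)))
        (Metric.ball_subset_ball (by rw [pow_succ]; nlinarith)) (by
          have := hdbl (r * (1 / 2) ^ (n + 1)) (by positivity)
          rwa [show 2 * (r * (1 / 2) ^ (n + 1)) = r * (1 / 2) ^ n by rw [pow_succ]; ring] at this)
      refine (abs_sub_le _ _ _).trans ((add_le_add hstep ih).trans (le_of_eq ?_))
      rw [pow_succ]
      ring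
  -- The last step passes to a closed ball, as in `hleb`. Its cost `L * r * (1 / 2) ^ n` fits into
  -- the `2 * L * r * (1 / 2) ^ n` still unspent.
  have hclosed : ∀ n : ℕ, |(⨍ y in Metric.closedBall x (r * (1 / 2) ^ (n + 1)), v y ∂μ) -
      ⨍ y in Metric.ball x r, v y ∂μ| ≤ 2 * L * r := by
    intro n
    have hn : 0 < r * (1 / 2) ^ n := by positivity
    have hstep := hosc (r * (1 / 2) ^ n) hn (Metric.closedBall x (r * (1 / 2) ^ (n + 1)))
      (Metric.closedBall_subset_ball (by rw [pow_succ]; nlinarith)) (by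
        have := hdbl (r * (1 / 2) ^ (n + 1)) (by positivity)
        rw [show 2 * (r * (1 / 2) ^ (n + 1)) = r * (1 / 2) ^ n by rw [pow_succ]; ring] at this
        refine this.trans ?_
        gcongr
        exact Metric.ball_subset_closedBall)
    refine (abs_sub_le _ _ _).trans ((add_le_add hstep (hchain n)).trans ?_)
    have : 0 ≤ L * r * (1 / 2) ^ n := by positivity
    nlinarith
  have hlim : Tendsto (fun n : ℕ => r * (1 / 2 : ℝ) ^ (n + 1)) atTop (𝓝[>] 0) := by
    refine tendsto_nhdsWithin_iff.2 ⟨?_, Eventually.of_forall fun n => by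
      simp only [Set.mem_Ioi]; positivity⟩
    have h := (tendsto_pow_atTop_nhds_zero_of_lt_one (r := (1 / 2 : ℝ)) (by norm_num)
      (by norm_num)).comp (tendsto_add_atTop_nat 1)
    simpa using h.const_mul r
  exact le_of_tendsto ((hleb _ hlim).sub_const _).abs (Eventually.of_forall hclosed)

theorem laverage_ball_le_maximalFunction (p : ℝ) (u : P → EReal) {x y : P} {r : ℝ}
    (hr : 0 < r) (hx : x ∈ Metric.ball y r) :
    (⨍⁻ z in Metric.ball y r, (u z).abs ^ p ∂μ) ^ (1 / p) ≤ maximalFunction μ p u x :=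
  le_iSup_of_le y (le_iSup_of_le r (le_iSup_of_le hr (le_iSup_of_le hx le_rfl)))

/-- The balls are not centred, so a ball that witnesses a large mean at one point does so at all its
points. This makes the level sets Borel. -/
theorem isOpen_lt_maximalFunction (p : ℝ) (u : P → EReal) (a : ℝ≥0∞) :
    IsOpen {x | a < maximalFunction μ p u x} := by
  rw [Metric.isOpen_iff]
  intro x hx
  simp only [Set.mem_ofPred_eq, maximalFunction, lt_iSup_iff] at hx
  obtain ⟨y, r, hr, hxy, h⟩ := hx
  obtain ⟨ε, hε, hsub⟩ := Metric.isOpen_iff.1 Metric.isOpen_ball x hxy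
  exact ⟨ε, hε, fun z hz => h.trans_le (laverage_ball_le_maximalFunction p u hr (hsub hz))⟩

theorem abs_coe_ennreal (a : ℝ≥0∞) : (a : EReal).abs = a := by
  induction a with
  | top => rfl
  | coe a =>
    rw [show ((a : ℝ≥0∞) : EReal) = ((a : ℝ) : EReal) from rfl, EReal.abs_def, abs_of_nonneg (NNReal.coe_nonneg a),
      ENNReal.ofReal_coe_nnreal]

/-- A bounded function with an upper gradient `g` is, up to a null set, Lipschitz with constant
comparable to `σ` where the maximal function of `g` is at most `σ`. -/
theorem exists_lipschitzOnWith_of_supportsPoincare [BorelSpace P]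
    (hμ : IsDoublingMetricMeasure μ) {p : ℝ} (hP : SupportsPoincare μ p) :
    ∃ K : ℝ≥0, ∀ (v : P → ℝ) (k : ℝ), AEMeasurable v μ → (∀ x, |v x| ≤ k) →
      ∀ g : P → ℝ≥0∞, IsUpperGradient g (fun x => (v x : EReal)) →
        ∃ N : Set P, MeasurableSet N ∧ μ N = 0 ∧ ∀ σ : ℝ≥0, LipschitzOnWith (K * σ) v
          ({x | (σ : ℝ≥0∞) < maximalFunction μ p (fun x => (g x : EReal)) x} ∪ N)ᶜ := by
  obtain ⟨c, hc1, hc⟩ := exists_one_le_doubling hμ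
  obtain ⟨cP, -, lam, hlam, hPI⟩ := hP
  -- With d = dist x y, the passage from v x to the mean over B(x, 2d) costs 4Ld, from there to the
  -- mean over B(y, d) 2Ld, and from there to v y 2Ld: in all 8Ld. In L, `c * c` compares B(x, 2d)
  -- with B(y, d) and `2` comes from the diameter bound 2r.
  refine ⟨8 * (c * c * (cP * 2)), fun v k hv hk g hg => ?_⟩
  have := hμ.secondCountableTopology
  have := hμ.isUnifLocDoublingMeasure
  have := hμ.isLocallyFiniteMeasure
  have hball : ∀ (x : P) (r : ℝ), 0 < r → μ (Metric.ball x r) ≠ ∞ :=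
    fun x r hr => (hμ.ball_lt_top x r hr).ne
  have hloc : LocallyIntegrable v μ := fun x => ⟨Metric.ball x 1,
    Metric.ball_mem_nhds x one_pos, integrableOn_of_abs_le hv hk (hball x 1 one_pos)⟩
  have hae : ∀ᵐ x ∂μ, ∀ δ : ℕ → ℝ, Tendsto δ atTop (𝓝[>] 0) →
      Tendsto (fun n => ⨍ y in Metric.closedBall x (δ n), v y ∂μ) atTop (𝓝 (v x)) := by
    filter_upwards [IsUnifLocDoublingMeasure.ae_tendsto_average μ hloc 1] with x hx δ hδ
    refine hx (fun _ => x) δ hδ ?_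
    filter_upwards [hδ.eventually self_mem_nhdsWithin] with n hn
    simpa using (le_of_lt hn : (0 : ℝ) ≤ δ n)
  -- Measurability of the exceptional set matters later, when an upper gradient is multiplied by an
  -- indicator and must stay Borel.
  obtain ⟨N, hsub, hN, hN0⟩ := exists_measurable_superset_of_null (ae_iff.1 hae)
  refine ⟨N, hN, hN0, fun σ => ?_⟩
  have hleb : ∀ x ∉ N, ∀ δ : ℕ → ℝ, Tendsto δ atTop (𝓝[>] 0) →
      Tendsto (fun n => ⨍ y in Metric.closedBall x (δ n), v y ∂μ) atTop (𝓝 (v x)) := by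
    exact fun x hx => not_not.1 fun h => hx (hsub h)
  have hint : IsLocallyIntegrable μ (fun x => (v x : EReal)) := by
    refine ⟨hv.coe_real_ereal, fun x r hr => ?_⟩
    have h := (integrableOn_of_abs_le hv hk (hball x r hr)).hasFiniteIntegral
    refine lt_of_le_of_lt (lintegral_mono fun z => ?_) h
    rw [EReal.abs_def, Real.enorm_eq_ofReal_abs]
  set L : ℝ := ((c * c * (cP * 2) * σ : ℝ≥0) : ℝ) with hLdef
  have hL : 0 ≤ L := NNReal.coe_nonneg _
  have hosc : ∀ x, ¬ ((σ : ℝ≥0∞) < maximalFunction μ p (fun x => (g x : EReal)) x) →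
      ∀ r, 0 < r → ∀ A ⊆ Metric.ball x r,
        μ (Metric.ball x r) ≤ (c * c : ℝ≥0) * μ A →
      |(⨍ y in A, v y ∂μ) - ⨍ y in Metric.ball x r, v y ∂μ| ≤ L * r := by
    intro x hx r hr A hA hAm
    have hA0 : 0 < μ A := by
      refine pos_iff_ne_zero.2 fun h => ?_
      rw [h, mul_zero] at hAm
      exact (hμ.ball_pos x r hr).not_ge hAm
    have h1 := enorm_setAverage_sub_le hA hA0 (hball x r hr) hAm
      (integrableOn_of_abs_le hv hk (measure_ne_top_of_subset hA (hball x r hr)))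
      (⨍ y in Metric.ball x r, v y ∂μ)
    have h2 := hPI x r hr _ hint g hg
    -- The dilated ball contains x, so its mean is one of those in the supremum.
    have h3 := (laverage_ball_le_maximalFunction (μ := μ) p (fun x => (g x : EReal))
      (by positivity : 0 < lam * r) (Metric.mem_ball_self (x := x) (by positivity))).trans
        (not_lt.1 hx)
    simp only [abs_coe_ennreal] at h3
    simp only [EReal.toReal_coe, ← EReal.coe_sub, EReal.abs_def, ← Real.enorm_eq_ofReal_abs] at h2
    have h4 : Metric.ediam (Metric.ball x r) ≤ ENNReal.ofReal (2 * r) := by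
      rw [← Metric.eball_ofReal, ENNReal.ofReal_mul zero_le_two]
      simpa using Metric.ediam_eball_le (x := x) (r := ENNReal.ofReal r)
    have h5 : ‖(⨍ y in A, v y ∂μ) - ⨍ y in Metric.ball x r, v y ∂μ‖ₑ ≤ ENNReal.ofReal (L * r) := by
      calc _ ≤ _ := h1
        _ ≤ (c * c : ℝ≥0) * (cP * ENNReal.ofReal (2 * r) * σ) := by
          gcongr
          exact h2.trans (by gcongr)
        _ = _ := by
          rw [hLdef, ENNReal.ofReal_mul (NNReal.coe_nonneg _), ENNReal.ofReal_coe_nnreal,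
            ENNReal.ofReal_mul zero_le_two]
          push_cast
          rw [ENNReal.ofReal_ofNat]
          ring
    rw [Real.enorm_eq_ofReal_abs] at h5
    exact (ENNReal.ofReal_le_ofReal_iff (by positivity)).1 h5
  have hdbl : ∀ (x : P) (r : ℝ), 0 < r →
      μ (Metric.ball x (2 * r)) ≤ (c * c : ℝ≥0) * μ (Metric.ball x r) := fun x r hr =>
    (hc x r hr).trans (by gcongr; exact_mod_cast le_mul_of_one_le_left' hc1)
  refine LipschitzOnWith.of_dist_le_mul fun x hx y hy => ?_
  simp only [Set.mem_compl_iff, Set.mem_union, Set.mem_ofPred_eq, not_or] at hx hy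
  rcases eq_or_ne x y with rfl | hxy
  · simp
  have hd : 0 < dist x y := dist_pos.2 hxy
  have hx1 := abs_average_ball_sub_le hL (hdbl x) (hosc x hx.1) (hleb x hx.2)
    (r := 2 * dist x y) (by positivity)
  have hy1 := abs_average_ball_sub_le hL (hdbl y) (hosc y hy.1) (hleb y hy.2) hd
  have hxy1 := hosc x hx.1 (2 * dist x y) (by positivity) (Metric.ball y (dist x y))
    (Metric.ball_subset_ball' (by rw [dist_comm y x]; linarith)) (by
      calc μ (Metric.ball x (2 * dist x y)) ≤ μ (Metric.ball y (2 * (2 * dist x y))) :=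
            measure_mono (Metric.ball_subset_ball' (by linarith))
        _ ≤ c * μ (Metric.ball y (2 * dist x y)) := hc y _ (by positivity)
        _ ≤ c * (c * μ (Metric.ball y (dist x y))) := by gcongr; exact hc y _ hd
        _ = _ := by push_cast; ring)
  have hK : ((8 * (c * c * (cP * 2)) * σ : ℝ≥0) : ℝ) = 8 * L := by
    rw [hLdef]; push_cast; ring
  rw [hK, Real.dist_eq]
  rw [abs_le] at *
  constructor <;> linarith [hx1.1, hx1.2, hy1.1, hy1.2, hxy1.1, hxy1.2]

end Oscillation

/-! ### Unit speed curves and functions on an interval -/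

section Curves

theorem HasUnitSpeedOn.mono {E : Type*} [PseudoEMetricSpace E] {γ : ℝ → E} {l a b : ℝ}
    (h : HasUnitSpeedOn γ (Set.Icc 0 l)) (ha : 0 ≤ a) (hb : b ≤ l) :
    HasUnitSpeedOn γ (Set.Icc a b) := by
  intro x hx y hy
  have := h (x := x) ⟨ha.trans hx.1, hx.2.trans hb⟩ (y := y) ⟨ha.trans hy.1, hy.2.trans hb⟩
  rw [← this]
  congr 1
  ext t
  simp only [Set.mem_inter_iff, Set.mem_Icc] at *
  constructor <;> rintro ⟨_, _, _⟩ <;> refine ⟨⟨?_, ?_⟩, ?_, ?_⟩ <;> linarith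

theorem HasUnitSpeedOn.comp_add_right {E : Type*} [PseudoEMetricSpace E] {γ : ℝ → E} {a b : ℝ}
    (h : HasUnitSpeedOn γ (Set.Icc a b)) :
    HasUnitSpeedOn (fun t => γ (t + a)) (Set.Icc 0 (b - a)) := by
  intro x hx y hy
  have h1 := h (x := x + a) ⟨by linarith [hx.1], by linarith [hx.2]⟩
    (y := y + a) ⟨by linarith [hy.1], by linarith [hy.2]⟩
  have h2 := eVariationOn.comp_eq_of_monotoneOn γ (t := Set.Icc 0 (b - a) ∩ Set.Icc x y)
    (fun t => t + a) (fun s _ t _ hst => add_le_add_left hst a)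
  have h3 : (fun t => t + a) '' (Set.Icc 0 (b - a) ∩ Set.Icc x y) =
      Set.Icc a b ∩ Set.Icc (x + a) (y + a) := by
    rw [Set.image_inter (add_left_injective a), Set.image_add_const_Icc, Set.image_add_const_Icc]
    simp
  rw [h3, h1] at h2
  change eVariationOn (γ ∘ fun t => t + a) _ = _
  rw [h2]
  congr 2
  ring

theorem HasUnitSpeedOn.edist_le {E : Type*} [PseudoEMetricSpace E] {γ : ℝ → E} {l : ℝ}
    (hl : 0 ≤ l) (h : HasUnitSpeedOn γ (Set.Icc 0 l)) :
    edist (γ 0) (γ l) ≤ ENNReal.ofReal l := by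
  have h1 := h (x := 0) ⟨le_rfl, hl⟩ (y := l) ⟨hl, le_rfl⟩
  have h2 := eVariationOn.edist_le γ (s := Set.Icc 0 l ∩ Set.Icc 0 l) (x := 0) (y := l)
    (by simp [hl]) (by simp [hl])
  rw [h1] at h2
  simpa using h2

theorem setLIntegral_Icc_comp_add_right (f : ℝ → ℝ≥0∞) (a b : ℝ) :
    ∫⁻ t in Set.Icc 0 (b - a), f (t + a) = ∫⁻ t in Set.Icc a b, f t := by
  have h := (measurePreserving_add_right volume a).setLIntegral_comp_emb
    (measurableEmbedding_addRight a) f (Set.Icc 0 (b - a))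
  rw [Set.image_add_const_Icc] at h
  simpa using h

/-- A function on an interval whose increments are controlled by the integral of `h`, and that
vanishes off `S`, has its total increment controlled by the integral of `h` over `S`. -/
theorem enorm_sub_le_setLIntegral_indicator {φ : ℝ → ℝ} {h : ℝ → ℝ≥0∞} {l : ℝ} (hl : 0 < l)
    (hfin : ∫⁻ t in Set.Icc 0 l, h t ≠ ∞)
    (hφ : ∀ a b, 0 ≤ a → a < b → b ≤ l → ‖φ a - φ b‖ₑ ≤ ∫⁻ t in Set.Icc a b, h t)
    {S : Set ℝ} (hS : ∀ t ∈ Set.Icc 0 l, t ∉ S → φ t = 0) :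
    ‖φ 0 - φ l‖ₑ ≤ ∫⁻ t in Set.Icc 0 l, S.indicator h t := by
  have hφ' : ∀ a b, 0 ≤ a → a ≤ b → b ≤ l → ‖φ a - φ b‖ₑ ≤ ∫⁻ t in Set.Icc a b, h t := by
    intro a b ha hab hb
    rcases hab.eq_or_lt with rfl | hab
    · simp
    · exact hφ a b ha hab hb
  -- Absolute continuity of the integral of `h`.
  have hcont : ContinuousOn φ (Set.Icc 0 l) := by
    rw [EMetric.continuousOn_iff]
    intro a ha ε hε
    obtain ⟨δ, hδ, hδ'⟩ := exists_pos_setLIntegral_lt_of_measure_lt hfin hε.ne'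
    have key : ∀ x y, x ∈ Set.Icc 0 l → y ∈ Set.Icc 0 l → x ≤ y → edist x y < δ →
        edist (φ x) (φ y) < ε := by
      intro x y hx hy hxy hd
      rw [edist_eq_enorm_sub]
      refine (hφ' x y hx.1 hxy hy.2).trans_lt ?_
      have := hδ' (Set.Icc x y) (by
        refine (Measure.restrict_apply_le _ _).trans_lt ?_
        rw [Real.volume_Icc]
        rwa [edist_comm, edist_dist, Real.dist_eq, abs_of_nonneg (by linarith)] at hd)
      rwa [Measure.restrict_restrict_of_subset (Set.Icc_subset_Icc hx.1 hy.2)] at this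
    refine ⟨δ, hδ, fun b hb hd => ?_⟩
    rcases le_total b a with hba | hab
    · exact key b a hb ha hba hd
    · rw [edist_comm]
      exact key a b ha hb hab (by rwa [edist_comm])
  -- The zero set is closed and everything outside it lies in `S`. Only the stretches before the
  -- first zero and after the last one contribute.
  set Z : Set ℝ := Set.Icc 0 l ∩ φ ⁻¹' {0} with hZ
  have hZc : IsCompact Z :=
    isCompact_Icc.of_isClosed_subset (hcont.preimage_isClosed_of_isClosed isClosed_Icc
      isClosed_singleton) Set.inter_subset_left
  have hSZ : ∀ t ∈ Set.Icc 0 l, t ∉ Z → S.indicator h t = h t := fun t ht htZ =>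
    Set.indicator_of_mem (by_contra fun htS => htZ ⟨ht, hS t ht htS⟩) h
  rcases Z.eq_empty_or_nonempty with hempty | hne
  · refine (hφ 0 l le_rfl hl le_rfl).trans (le_of_eq ?_)
    refine setLIntegral_congr_fun measurableSet_Icc fun t ht => (hSZ t ht ?_).symm
    rw [hempty]
    exact Set.notMem_empty t
  obtain ⟨a, haZ, ha⟩ := hZc.exists_isLeast hne
  obtain ⟨b, hbZ, hb⟩ := hZc.exists_isGreatest hne
  have hab : a ≤ b := ha hbZ
  -- The endpoint `a` is a zero and may lie outside `S`, hence the half-open interval.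
  have h0 : ‖φ 0‖ₑ ≤ ∫⁻ t in Set.Ico 0 a, S.indicator h t := by
    have h1 := hφ' 0 a le_rfl haZ.1.1 haZ.1.2
    rw [show φ a = 0 from haZ.2, sub_zero, ← setLIntegral_congr Ico_ae_eq_Icc] at h1
    refine h1.trans (le_of_eq (setLIntegral_congr_fun measurableSet_Ico fun t ht => ?_))
    exact (hSZ t ⟨ht.1, ht.2.le.trans haZ.1.2⟩ fun htZ => (ha htZ).not_gt ht.2).symm
  have h1 : ‖φ l‖ₑ ≤ ∫⁻ t in Set.Ioc b l, S.indicator h t := by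
    have h1 := hφ' b l hbZ.1.1 hbZ.1.2 le_rfl
    rw [show φ b = 0 from hbZ.2, zero_sub, enorm_neg, ← setLIntegral_congr Ioc_ae_eq_Icc] at h1
    refine h1.trans (le_of_eq (setLIntegral_congr_fun measurableSet_Ioc fun t ht => ?_))
    exact (hSZ t ⟨hbZ.1.1.trans ht.1.le, ht.2⟩ fun htZ => (hb htZ).not_gt ht.1).symm
  calc ‖φ 0 - φ l‖ₑ ≤ ‖φ 0‖ₑ + ‖φ l‖ₑ := enorm_sub_le
    _ ≤ _ := add_le_add h0 h1
    _ = ∫⁻ t in Set.Ico 0 a ∪ Set.Ioc b l, S.indicator h t := by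
      refine (lintegral_union measurableSet_Ioc ?_).symm
      exact Set.disjoint_left.2 fun t ht ht' => by linarith [ht.2, ht'.1]
    _ ≤ ∫⁻ t in Set.Icc 0 l, S.indicator h t := lintegral_mono_set (Set.union_subset
      (fun t ht => ⟨ht.1, ht.2.le.trans haZ.1.2⟩) fun t ht => ⟨hbZ.1.1.trans ht.1.le, ht.2⟩)

end Curves

/-! ### Calculus of upper gradients -/

namespace EReal

/-- Since `⊤ - ⊤` and `⊥ - ⊥` are `⊥`, any infinite entry makes the absolute difference `⊤`. Upper
bounds by `(a - b).abs` thus need checking for real numbers only. -/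
theorem abs_sub_eq_top_or (a b : EReal) :
    (a - b).abs = ⊤ ∨ ∃ x y : ℝ, a = x ∧ b = y := by
  induction a <;> induction b <;> simp [← EReal.coe_sub]

theorem abs_coe_sub_coe (x y : ℝ) : ((x : EReal) - (y : EReal)).abs = ‖x - y‖ₑ := by
  rw [← EReal.coe_sub, EReal.abs_def, Real.enorm_eq_ofReal_abs]

end EReal

namespace IsUpperGradient

variable {P : Type*} [MetricSpace P] [MeasurableSpace P] {g : P → ℝ≥0∞} {u : P → EReal}

/-- A subarc, shifted to start at parameter 0, is again an admissible curve. -/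
theorem abs_sub_le (hg : IsUpperGradient g u) {l : ℝ} {γ : ℝ → P}
    (hγ : HasUnitSpeedOn γ (Set.Icc 0 l)) {a b : ℝ} (ha : 0 ≤ a) (hab : a < b) (hb : b ≤ l) :
    (u (γ a) - u (γ b)).abs ≤ ∫⁻ t in Set.Icc a b, g (γ t) := by
  have h := hg.2 (b - a) (fun t => γ (t + a)) (by linarith) (hγ.mono ha hb).comp_add_right
  rw [setLIntegral_Icc_comp_add_right (fun t => g (γ t))] at h
  simpa using h

/-- Along a curve on which `g` is integrable, `u` is finite. -/
theorem coe_toReal (hg : IsUpperGradient g u) {l : ℝ} (hl : 0 < l) {γ : ℝ → P}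
    (hγ : HasUnitSpeedOn γ (Set.Icc 0 l)) (hfin : ∫⁻ t in Set.Icc 0 l, g (γ t) ≠ ∞)
    {t : ℝ} (ht : t ∈ Set.Icc 0 l) : ((u (γ t)).toReal : EReal) = u (γ t) := by
  -- At t = 0 the arc from 0 to t degenerates, so the far endpoint is used instead.
  rcases ht.1.eq_or_lt with rfl | h0
  · rcases EReal.abs_sub_eq_top_or (u (γ 0)) (u (γ l)) with h | ⟨x, y, hx, -⟩
    · exact absurd (top_le_iff.1 (h ▸ hg.2 l γ hl hγ)) hfin
    · rw [hx, EReal.toReal_coe]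
  · rcases EReal.abs_sub_eq_top_or (u (γ 0)) (u (γ t)) with h | ⟨x, y, -, hy⟩
    · have h1 := (hg.abs_sub_le hγ le_rfl h0 ht.2).trans
        (lintegral_mono_set (Set.Icc_subset_Icc_right ht.2))
      exact absurd (top_le_iff.1 (h ▸ h1)) hfin
    · rw [hy, EReal.toReal_coe]

/-- Localization of an upper gradient of `w` to a set off which `w` vanishes. The small multiple
of `g` makes the estimate trivial along the curves on which `g` is not integrable. -/
theorem indicator_add (hg : Measurable g) {K : ℝ≥0} {w : P → EReal}
    (hw : IsUpperGradient (fun x => g x + K) w) {F : Set P} (hF : MeasurableSet F)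
    (hwF : ∀ x ∉ F, w x = 0) {δ : ℝ≥0} (hδ : δ ≠ 0) :
    IsUpperGradient (fun x => F.indicator (fun x => g x + K) x + δ * g x) w := by
  refine ⟨(hw.1.indicator hF).add (hg.const_mul _), fun l γ hl hγ => ?_⟩
  by_cases hfin : ∫⁻ t in Set.Icc 0 l, g (γ t) = ∞
  · refine le_trans ?_ (lintegral_mono fun t => le_add_self)
    rw [lintegral_const_mul' _ _ ENNReal.coe_ne_top, hfin,
      ENNReal.mul_top (by exact_mod_cast hδ)]
    exact le_top
  have hfin' : ∫⁻ t in Set.Icc 0 l, (g (γ t) + K) ≠ ∞ := by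
    rw [lintegral_add_right _ measurable_const]
    exact ENNReal.add_ne_top.2 ⟨hfin, by simp [ENNReal.mul_eq_top]⟩
  refine le_trans ?_ (lintegral_mono fun t => le_self_add)
  have hreal := fun t ht => hw.coe_toReal hl hγ hfin' (t := t) ht
  have key := enorm_sub_le_setLIntegral_indicator (φ := fun t => (w (γ t)).toReal) hl hfin'
    (S := γ ⁻¹' F) ?_ ?_
  · rw [← hreal 0 ⟨le_rfl, hl.le⟩, ← hreal l ⟨hl.le, le_rfl⟩, EReal.abs_coe_sub_coe]
    exact key
  · intro a b ha hab hb
    have h := hw.abs_sub_le hγ ha hab hb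
    rwa [← hreal a ⟨ha, by linarith⟩, ← hreal b ⟨by linarith, hb⟩, EReal.abs_coe_sub_coe] at h
  · intro t _ ht
    simp [hwF _ ht]

/-- Meant for compositions of `u` with 1-Lipschitz maps. -/
theorem mono {h : P → ℝ≥0∞} (hg : IsUpperGradient g u) {w : P → EReal} (hh : Measurable h)
    (hgh : ∀ x, g x ≤ h x) (huw : ∀ x y, (w x - w y).abs ≤ (u x - u y).abs) :
    IsUpperGradient h w :=
  ⟨hh, fun l γ hl hγ => (huw _ _).trans
    ((hg.2 l γ hl hγ).trans (lintegral_mono fun _ => hgh _))⟩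

theorem add {h : P → ℝ≥0∞} {w : P → ℝ} (hg : IsUpperGradient g u)
    (hh : IsUpperGradient h (fun x => (w x : EReal))) :
    IsUpperGradient (fun x => g x + h x) (fun x => u x + (w x : EReal)) := by
  refine ⟨hg.1.add hh.1, fun l γ hl hγ => ?_⟩
  refine le_trans ?_ (le_lintegral_add _ _)
  have h1 := hg.2 l γ hl hγ
  have h2 := hh.2 l γ hl hγ
  -- When `u` is infinite at an endpoint, the integral of `g` is already infinite.
  rcases EReal.abs_sub_eq_top_or (u (γ 0)) (u (γ l)) with h | ⟨x, y, hx, hy⟩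
  · rw [h, top_le_iff] at h1
    simp [h1]
  · refine le_trans ?_ (add_le_add h1 h2)
    beta_reduce
    rw [hx, hy, ← EReal.coe_add, ← EReal.coe_add]
    simp only [EReal.abs_coe_sub_coe]
    rw [add_sub_add_comm]
    exact enorm_add_le _ _

theorem neg (hg : IsUpperGradient g u) {w : P → ℝ} (hw : ∀ x, u x = w x) :
    IsUpperGradient g (fun x => ((-w x : ℝ) : EReal)) :=
  hg.mono hg.1 (fun _ => le_rfl) fun x y => by
    rw [hw, hw, EReal.abs_coe_sub_coe, EReal.abs_coe_sub_coe, ← enorm_neg]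
    exact le_of_eq (congrArg _ (by ring))

theorem of_lipschitzWith {K : ℝ≥0} {f : P → ℝ} (hf : LipschitzWith K f) :
    IsUpperGradient (fun _ => (K : ℝ≥0∞)) (fun x => (f x : EReal)) := by
  refine ⟨measurable_const, fun l γ hl hγ => ?_⟩
  rw [EReal.abs_coe_sub_coe, ← edist_eq_enorm_sub]
  refine (hf _ _).trans ?_
  simp only [lintegral_const, Measure.restrict_apply_univ, Real.volume_Icc, sub_zero]
  gcongr
  exact hγ.edist_le hl.le

end IsUpperGradient

theorem coe_ennreal_natCast (n : ℕ) : ((n : ℝ≥0∞) : EReal) = n := by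
  rw [show (n : ℝ≥0∞) = ((n : ℝ≥0) : ℝ≥0∞) by simp,
    show (((n : ℝ≥0) : ℝ≥0∞) : EReal) = (((n : ℝ≥0) : ℝ) : EReal) from rfl]
  simp

/-! ### Truncation of extended real numbers -/

namespace EReal

/-- Truncation of an extended real number to `[-k, k]`. -/
noncomputable def truncate (k : ℝ) (a : EReal) : ℝ := (max (-(k : EReal)) (min (k : EReal) a)).toReal

variable {k : ℝ}

theorem truncate_coe (x : ℝ) : truncate k x = max (-k) (min k x) := by
  rw [truncate, ← EReal.coe_neg, ← EReal.coe_strictMono.monotone.map_min,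
    ← EReal.coe_strictMono.monotone.map_max, EReal.toReal_coe]

theorem truncate_top (hk : 0 ≤ k) : truncate k ⊤ = k := by
  rw [truncate, min_eq_left le_top, ← EReal.coe_neg,
    ← EReal.coe_strictMono.monotone.map_max, EReal.toReal_coe, max_eq_right (by linarith)]

theorem truncate_bot : truncate k ⊥ = -k := by
  rw [truncate, min_eq_right bot_le, max_eq_left bot_le, ← EReal.coe_neg, EReal.toReal_coe]

theorem abs_truncate_le (hk : 0 ≤ k) (a : EReal) : |truncate k a| ≤ k := by
  induction a with
  | bot => rw [truncate_bot, abs_neg, abs_of_nonneg hk]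
  | top => rw [truncate_top hk, abs_of_nonneg hk]
  | coe x =>
    rw [truncate_coe, abs_le]
    exact ⟨le_max_left _ _, max_le (by linarith) (min_le_left _ _)⟩

theorem measurable_truncate : Measurable (truncate k) :=
  (measurable_const.max (measurable_const.min measurable_id)).ereal_toReal

theorem measurable_abs : Measurable EReal.abs :=
  EReal.measurable_of_measurable_real
    (ENNReal.measurable_ofReal.comp (continuous_abs.measurable (α := ℝ)))

theorem measurable_sub_truncate : Measurable fun a : EReal => a - (truncate k a : EReal) := by
  have h : Measurable fun a : EReal => a + ((-truncate k a : ℝ) : EReal) :=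
    measurable_id.add measurable_truncate.neg.coe_real_ereal
  simpa only [sub_eq_add_neg, EReal.coe_neg] using h

theorem abs_coe (x : ℝ) : (x : EReal).abs = ‖x‖ₑ := by
  rw [EReal.abs_def, Real.enorm_eq_ofReal_abs]

theorem abs_truncate_le_abs (hk : 0 ≤ k) (a : EReal) : (truncate k a : EReal).abs ≤ a.abs := by
  induction a with
  | bot => simp
  | top => simp
  | coe x =>
    rw [truncate_coe, EReal.abs_def, EReal.abs_def]
    refine ENNReal.ofReal_le_ofReal ?_
    rw [abs_le]
    rcases abs_cases x with ⟨h, _⟩ | ⟨h, _⟩ <;> rw [h] <;>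
      constructor <;> grind

theorem abs_truncate_sub_le (a b : EReal) :
    ((truncate k a : EReal) - (truncate k b : EReal)).abs ≤ (a - b).abs := by
  rcases abs_sub_eq_top_or a b with h | ⟨x, y, rfl, rfl⟩
  · rw [h]; exact le_top
  · rw [truncate_coe, truncate_coe, abs_coe_sub_coe, abs_coe_sub_coe, Real.enorm_eq_ofReal_abs,
      Real.enorm_eq_ofReal_abs]
    refine ENNReal.ofReal_le_ofReal ?_
    exact (abs_max_sub_max_le_max _ _ _ _).trans (max_le (by simp)
      ((abs_min_sub_min_le_max _ _ _ _).trans (max_le (by simp) le_rfl)))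

theorem sub_truncate_eq_zero {a : EReal} (ha : a.abs ≤ ENNReal.ofReal k) (hk : 0 ≤ k) :
    a - (truncate k a : EReal) = 0 := by
  induction a with
  | bot => simp at ha
  | top => simp at ha
  | coe x =>
    rw [EReal.abs_def, ENNReal.ofReal_le_ofReal_iff hk, abs_le] at ha
    rw [truncate_coe, min_eq_right ha.2, max_eq_right ha.1, ← EReal.coe_sub, _root_.sub_self,
      EReal.coe_zero]

theorem abs_sub_truncate_le (hk : 0 ≤ k) (a : EReal) :
    (a - (truncate k a : EReal)).abs ≤ a.abs := by
  induction a with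
  | bot => simp
  | top => simp
  | coe x =>
    rw [truncate_coe, abs_coe_sub_coe, EReal.abs_def, Real.enorm_eq_ofReal_abs]
    refine ENNReal.ofReal_le_ofReal ?_
    rw [abs_le]
    rcases abs_cases x with ⟨h, _⟩ | ⟨h, _⟩ <;> rw [h] <;>
      constructor <;> grind

/-- Truncation is nondecreasing and 1-Lipschitz, hence so is its difference from the identity; an
upper gradient of u therefore remains one for the truncation error. -/
theorem abs_sub_truncate_sub_le (a b : EReal) :
    ((a - (truncate k a : EReal)) - (b - (truncate k b : EReal))).abs ≤ (a - b).abs := by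
  rcases abs_sub_eq_top_or a b with h | ⟨x, y, rfl, rfl⟩
  · rw [h]; exact le_top
  · rw [truncate_coe, truncate_coe, ← EReal.coe_sub, ← EReal.coe_sub, abs_coe_sub_coe,
      abs_coe_sub_coe, Real.enorm_eq_ofReal_abs, Real.enorm_eq_ofReal_abs]
    refine ENNReal.ofReal_le_ofReal ?_
    rw [abs_le]
    rcases abs_cases (x - y) with ⟨h, _⟩ | ⟨h, _⟩ <;> rw [h] <;>
      constructor <;> grind

end EReal

/-- The localization leaves a multiple δ of g; the choice δ = 1 / (n + 1) is positive for each n and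
negligible in the limit. -/
theorem tendsto_inv_succ_mul {q : ℝ≥0∞} (hq : q ≠ ∞) :
    Tendsto (fun n : ℕ => (((1 / ((n : ℝ≥0) + 1) : ℝ≥0)) : ℝ≥0∞) * q) atTop (𝓝 0) := by
  have h : Tendsto (fun n : ℕ => ((1 / ((n : ℝ≥0) + 1) : ℝ≥0) : ℝ≥0∞)) atTop (𝓝 0) := by
    rw [← ENNReal.coe_zero]
    exact ENNReal.tendsto_coe.2 (tendsto_one_div_add_atTop_nhds_zero_nat (𝕜 := ℝ≥0))
  simpa using ENNReal.Tendsto.mul_const h (Or.inr hq)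

/-! ### The quasi-norm and the Newtonian norm -/

namespace QuasiBanachFunctionLattice

section Lattice

variable {P : Type*} [MeasurableSpace P] {μ : Measure P} (X : QuasiBanachFunctionLattice μ)

theorem qnorm_coe_add_le {g h : P → ℝ≥0∞} (hg : AEMeasurable g μ) (hh : AEMeasurable h μ) :
    X.qnorm (fun x => ((g x + h x : ℝ≥0∞) : EReal)) ≤
      X.modulus * (X.qnorm (fun x => (g x : EReal)) + X.qnorm (fun x => (h x : EReal))) := by
  simp only [EReal.coe_ennreal_add]
  exact X.qnorm_add_le _ _ hg.coe_ereal_ennreal hh.coe_ereal_ennreal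

theorem qnorm_coe_const_mul (δ : ℝ≥0) {g : P → ℝ≥0∞} (hg : AEMeasurable g μ) :
    X.qnorm (fun x => ((δ * g x : ℝ≥0∞) : EReal)) = δ * X.qnorm (fun x => (g x : EReal)) := by
  have h := X.qnorm_smul δ _ hg.coe_ereal_ennreal
  rw [abs_of_nonneg (NNReal.coe_nonneg δ), ENNReal.ofReal_coe_nnreal] at h
  rw [← h]
  simp only [EReal.coe_ennreal_mul]
  rfl

theorem qnorm_le_of_ae_le {u : P → EReal} {g : P → ℝ≥0∞} (hu : AEMeasurable u μ)
    (hg : AEMeasurable g μ) (h : ∀ᵐ x ∂μ, (u x).abs ≤ g x) :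
    X.qnorm u ≤ X.qnorm (fun x => (g x : EReal)) :=
  X.qnorm_mono _ _ hu hg.coe_ereal_ennreal (by simpa only [abs_coe_ennreal] using h)

/-- The function z equal to ∞ on {|u| = ∞} and 0 elsewhere satisfies 2z = z, so by homogeneity its
quasi-norm is 0 or ∞; it is finite because z ≤ |u|. -/
theorem ae_abs_ne_top {u : P → EReal} (hu : X.Mem u) : ∀ᵐ x ∂μ, (u x).abs ≠ ⊤ := by
  have habs : AEMeasurable (fun x => (u x).abs) μ := EReal.measurable_abs.comp_aemeasurable hu.1
  have hE : NullMeasurableSet {x | (u x).abs = ⊤} μ :=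
    habs.nullMeasurableSet_preimage (measurableSet_singleton ⊤)
  set z : P → ℝ≥0∞ := {x | (u x).abs = ⊤}.indicator (fun _ => ⊤) with hz
  have hzm : AEMeasurable z μ := aemeasurable_const.indicator₀ hE
  have hle : X.qnorm (fun x => (z x : EReal)) ≤ X.qnorm u := by
    refine X.qnorm_mono _ _ hzm.coe_ereal_ennreal hu.1 (Eventually.of_forall fun x => ?_)
    rw [abs_coe_ennreal, hz]
    by_cases hx : (u x).abs = ⊤
    · rw [hx]; exact le_top
    · rw [Set.indicator_of_notMem (show x ∉ {x | (u x).abs = ⊤} from hx)]; exact zero_le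
  have htwo := X.qnorm_coe_const_mul 2 hzm
  have h2z : (fun x => ((((2 : ℝ≥0) : ℝ≥0∞) * z x : ℝ≥0∞) : EReal)) = fun x => (z x : EReal) := by
    funext x
    rw [hz]
    by_cases hx : (u x).abs = ⊤
    · rw [Set.indicator_of_mem (show x ∈ {x | (u x).abs = ⊤} from hx)]
      rw [ENNReal.mul_top (by norm_num)]
    · rw [Set.indicator_of_notMem (show x ∉ {x | (u x).abs = ⊤} from hx), mul_zero]
  rw [h2z] at htwo
  have h0 : X.qnorm (fun x => (z x : EReal)) = 0 := by
    by_contra hne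
    have hfin := (hle.trans_lt hu.2).ne
    have := ENNReal.mul_lt_mul_left hne hfin (show (1 : ℝ≥0∞) < ((2 : ℝ≥0) : ℝ≥0∞) by norm_num)
    rw [one_mul, ← htwo] at this
    exact lt_irrefl _ this
  filter_upwards [(X.qnorm_eq_zero_iff _ hzm.coe_ereal_ennreal).1 h0] with x hx hxt
  have : z x = ⊤ := Set.indicator_of_mem (show x ∈ {x | (u x).abs = ⊤} from hxt) _
  rw [this] at hx
  simp at hx

/-- Lets null sets be adjoined and measurable hulls be taken at no cost in quasi-norm. -/
theorem qnorm_indicator_congr {F A : Set P} (h : F =ᵐ[μ] A) {u : P → EReal}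
    (hF : NullMeasurableSet F μ) (hu : AEMeasurable u μ) :
    X.qnorm (F.indicator u) = X.qnorm (A.indicator u) := by
  have hA : NullMeasurableSet A μ := hF.congr h
  have hind : F.indicator u =ᵐ[μ] A.indicator u := indicator_ae_eq_of_ae_eq_set h
  refine le_antisymm (X.qnorm_mono _ _ (hu.indicator₀ hF) (hu.indicator₀ hA) ?_)
    (X.qnorm_mono _ _ (hu.indicator₀ hA) (hu.indicator₀ hF) ?_)
  · filter_upwards [hind] with x hx
    rw [hx]
  · filter_upwards [hind] with x hx
    rw [hx]

end Lattice

variable {P : Type*} [MetricSpace P] [MeasurableSpace P] {μ : Measure P}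
  (X : QuasiBanachFunctionLattice μ)

theorem newtonNorm_lt_iff {u : P → EReal} {a : ℝ≥0∞} : X.newtonNorm u < a ↔
    ∃ g : P → ℝ≥0∞, IsUpperGradient g u ∧
      X.qnorm u + X.qnorm (fun x => (g x : EReal)) < a := by
  rw [newtonNorm, iInf_subtype', ENNReal.add_iInf, iInf_lt_iff, Subtype.exists]
  simp only [exists_prop]

theorem newtonNorm_le {u : P → EReal} {g : P → ℝ≥0∞} (hg : IsUpperGradient g u) :
    X.newtonNorm u ≤ X.qnorm u + X.qnorm (fun x => (g x : EReal)) :=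
  add_le_add le_rfl (iInf₂_le g hg)

/-- Strict bounds supply actual upper gradients without the infima having to be attained. -/
theorem newtonNorm_add_le {u : P → EReal} {w : P → ℝ} (hu : AEMeasurable u μ)
    (hw : AEMeasurable w μ) {a b : ℝ≥0∞} (ha : X.newtonNorm u < a)
    (hb : X.newtonNorm (fun x => (w x : EReal)) < b) :
    X.newtonNorm (fun x => u x + (w x : EReal)) ≤ X.modulus * (a + b) := by
  obtain ⟨g, hg, hga⟩ := X.newtonNorm_lt_iff.1 ha
  obtain ⟨h, hh, hhb⟩ := X.newtonNorm_lt_iff.1 hb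
  refine (X.newtonNorm_le (hg.add hh)).trans ?_
  refine (add_le_add (X.qnorm_add_le _ _ hu hw.coe_real_ereal)
    (X.qnorm_coe_add_le hg.1.aemeasurable hh.1.aemeasurable)).trans ?_
  rw [← mul_add]
  refine mul_le_mul_right ?_ _
  rw [add_add_add_comm]
  exact add_le_add hga.le hhb.le

theorem newtonNorm_neg_le {w : P → ℝ} (hw : AEMeasurable w μ) :
    X.newtonNorm (fun x => ((-w x : ℝ) : EReal)) ≤ X.newtonNorm (fun x => (w x : EReal)) := by
  refine le_of_forall_gt fun a ha => ?_
  obtain ⟨g, hg, hga⟩ := X.newtonNorm_lt_iff.1 ha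
  refine X.newtonNorm_lt_iff.2 ⟨g, hg.neg fun _ => rfl, lt_of_le_of_lt ?_ hga⟩
  gcongr
  exact X.qnorm_mono _ _ hw.neg.coe_real_ereal hw.coe_real_ereal
    (Eventually.of_forall fun x => by simp [EReal.abs_coe])

/-- The Newtonian norm of a function that vanishes off `F`. -/
theorem newtonNorm_le_indicator {g : P → ℝ≥0∞} (hg : Measurable g) {K : ℝ≥0} {w : P → EReal}
    (hw : IsUpperGradient (fun x => g x + K) w) {F : Set P} (hF : MeasurableSet F)
    (hwF : ∀ x ∉ F, w x = 0) {δ : ℝ≥0} (hδ : δ ≠ 0) :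
    X.newtonNorm w ≤ X.qnorm w + X.modulus *
      (X.qnorm (fun x => ((F.indicator (fun x => g x + K) x : ℝ≥0∞) : EReal)) +
        δ * X.qnorm (fun x => (g x : EReal))) := by
  refine (X.newtonNorm_le (IsUpperGradient.indicator_add hg hw hF hwF hδ)).trans ?_
  gcongr
  refine (X.qnorm_coe_add_le (hw.1.indicator hF).aemeasurable (hg.const_mul _).aemeasurable).trans ?_
  rw [X.qnorm_coe_const_mul δ hg.aemeasurable]

/-! ### Approximation by truncations and by Lipschitz functions -/

/-- Truncations converge in the Newtonian norm. -/
theorem tendsto_newtonNorm_sub_truncate (hX : X.AbsolutelyContinuous) {u : P → EReal}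
    (hu : X.MemNewton u) :
    Tendsto (fun n : ℕ => X.newtonNorm (fun x => u x - (EReal.truncate n (u x) : EReal)))
      atTop (𝓝 0) := by
  obtain ⟨g, hg, hgfin⟩ := X.newtonNorm_lt_iff.1 hu.2
  have huX : X.Mem u := ⟨hu.1, le_self_add.trans_lt hgfin⟩
  have hgX : X.Mem (fun x => (g x : EReal)) :=
    ⟨hg.1.aemeasurable.coe_ereal_ennreal, le_add_self.trans_lt hgfin⟩
  set A : ℕ → Set P := fun n => {x | (n : ℝ≥0∞) < (u x).abs} with hA
  have hAm : ∀ n, NullMeasurableSet (A n) μ := fun n =>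
    (EReal.measurable_abs.comp_aemeasurable hu.1).nullMeasurableSet_preimage measurableSet_Ioi
  have hAanti : Antitone A := fun m n hmn x hx =>
    lt_of_le_of_lt (by exact_mod_cast hmn) (show (n : ℝ≥0∞) < (u x).abs from hx)
  have hA0 : μ (⋂ n, A n) = 0 := by
    refine measure_mono_null (fun x hx => ?_) (ae_iff.1 (X.ae_abs_ne_top huX))
    refine not_not.2 (not_not.1 fun hne => ?_)
    obtain ⟨n, hn⟩ := ENNReal.exists_nat_gt hne
    exact (Set.mem_iInter.1 hx n).not_gt hn
  have hu0 := hX u huX A hAm hAanti hA0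
  have hg0 := hX _ hgX A hAm hAanti hA0
  have hbound : ∀ n : ℕ, X.newtonNorm (fun x => u x - (EReal.truncate n (u x) : EReal)) ≤
      X.qnorm ((A n).indicator u) + X.modulus *
        (X.qnorm ((A n).indicator fun x => (g x : EReal)) +
          (((1 / ((n : ℝ≥0) + 1) : ℝ≥0)) : ℝ≥0∞) * X.qnorm (fun x => (g x : EReal))) := by
    intro n
    have hzero : ∀ x ∉ A n, u x - (EReal.truncate n (u x) : EReal) = 0 := fun x hx =>
      EReal.sub_truncate_eq_zero (by rw [ENNReal.ofReal_natCast]; exact not_lt.1 hx)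
        (Nat.cast_nonneg n)
    have hw : IsUpperGradient (fun x => g x + (0 : ℝ≥0))
        (fun x => u x - (EReal.truncate n (u x) : EReal)) :=
      hg.mono (hg.1.add_const _) (fun x => le_self_add)
        fun x y => EReal.abs_sub_truncate_sub_le _ _
    -- `A n` is only null measurable, whereas the localized upper gradient must be Borel; hence the
    -- measurable hull.
    refine (X.newtonNorm_le_indicator hg.1 hw (measurableSet_toMeasurable μ (A n))
      (fun x hx => hzero x fun h => hx (subset_toMeasurable μ _ h))
      (δ := 1 / ((n : ℝ≥0) + 1)) (by positivity)).trans ?_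
    gcongr ?_ + _ * (?_ + _)
    · refine X.qnorm_mono _ _ (EReal.measurable_sub_truncate.comp_aemeasurable hu.1)
        (hu.1.indicator₀ (hAm n)) (Eventually.of_forall fun x => ?_)
      by_cases hx : x ∈ A n
      · rw [Set.indicator_of_mem hx]
        exact EReal.abs_sub_truncate_le (Nat.cast_nonneg n) _
      · rw [hzero x hx]
        simp
    · rw [← X.qnorm_indicator_congr (hAm n).toMeasurable_ae_eq
        (measurableSet_toMeasurable μ (A n)).nullMeasurableSet hgX.1]
      refine le_of_eq (congrArg _ (funext fun x => ?_))
      by_cases hx : x ∈ toMeasurable μ (A n)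
      · simp [Set.indicator_of_mem hx]
      · simp [Set.indicator_of_notMem hx]
  refine tendsto_of_tendsto_of_tendsto_of_le_of_le tendsto_const_nhds ?_ (fun _ => zero_le) hbound
  simpa using hu0.add (ENNReal.Tendsto.const_mul (hg0.add (tendsto_inv_succ_mul hgX.2.ne))
    (Or.inr (ENNReal.coe_ne_top (r := X.modulus))))

/-- The weak maximal estimate forces maximal functions to be finite almost everywhere. -/
theorem measure_iInter_lt_maximalFunction [BorelSpace P] {p : ℝ} {v : P → EReal}
    (hM : Tendsto (fun n : ℕ => X.qnorm
      ({x | (n : ℝ≥0∞) < maximalFunction μ p v x}.indicator (fun _ => (n : EReal))))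
      atTop (𝓝 0)) :
    μ (⋂ n : ℕ, {x | (n : ℝ≥0∞) < maximalFunction μ p v x}) = 0 := by
  set E : ℕ → Set P := fun n => {x | (n : ℝ≥0∞) < maximalFunction μ p v x} with hE
  have hEm : ∀ n, MeasurableSet (E n) := fun n =>
    (isOpen_lt_maximalFunction p v _).measurableSet
  have hIm : MeasurableSet (⋂ n, E n) := MeasurableSet.iInter hEm
  have hmeas : AEMeasurable ((⋂ n, E n).indicator fun _ => (1 : EReal)) μ :=
    (measurable_const.indicator hIm).aemeasurable
  -- For n ≥ 1 the indicator of the intersection is at most n times that of `E n`.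
  have h0 : X.qnorm ((⋂ n, E n).indicator fun _ => (1 : EReal)) = 0 := by
    refine le_antisymm (ge_of_tendsto hM ?_) zero_le
    filter_upwards [eventually_ge_atTop 1] with n hn
    refine X.qnorm_mono _ _ hmeas (measurable_const.indicator (hEm n)).aemeasurable
      (Eventually.of_forall fun x => ?_)
    by_cases hx : x ∈ ⋂ n, E n
    · rw [Set.indicator_of_mem hx, Set.indicator_of_mem (Set.mem_iInter.1 hx n)]
      rw [show (1 : EReal) = ((1 : ℝ≥0∞) : EReal) by simp,
        ← coe_ennreal_natCast, abs_coe_ennreal, abs_coe_ennreal]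
      exact_mod_cast hn
    · rw [Set.indicator_of_notMem hx]
      simp
  have hae := (X.qnorm_eq_zero_iff _ hmeas).1 h0
  refine measure_mono_null (fun x hx => ?_) (ae_iff.1 hae)
  have h1 : (⋂ n, E n).indicator (fun _ => (1 : EReal)) x = 1 := Set.indicator_of_mem hx _
  change ¬ _ = (0 : EReal)
  rw [h1]
  exact one_ne_zero

/-- Lipschitz functions are dense among the bounded Newtonian functions. -/
theorem exists_lipschitzWith_newtonNorm_sub_lt [BorelSpace P] (hμ : IsDoublingMetricMeasure μ)
    {p : ℝ} (hP : SupportsPoincare μ p) (hX : X.AbsolutelyContinuous)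
    (hM : ∀ v : P → EReal, X.Mem v →
      Tendsto (fun σ : ℝ => X.qnorm
        ({x | ENNReal.ofReal σ < maximalFunction μ p v x}.indicator (fun _ => (σ : EReal))))
        atTop (𝓝 0))
    {v : P → ℝ} (hv : AEMeasurable v μ) {k : ℝ} (hk0 : 0 ≤ k) (hk : ∀ x, |v x| ≤ k)
    (hvN : X.newtonNorm (fun x => (v x : EReal)) < ∞) {ε : ℝ≥0∞} (hε : 0 < ε) :
    ∃ f : P → ℝ, (∃ K : ℝ≥0, LipschitzWith K f) ∧
      X.newtonNorm (fun x => ((v x - f x : ℝ) : EReal)) < ε := by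
  obtain ⟨g, hg, hgfin⟩ := X.newtonNorm_lt_iff.1 hvN
  have hgX : X.Mem (fun x => (g x : EReal)) :=
    ⟨hg.1.aemeasurable.coe_ereal_ennreal, le_add_self.trans_lt hgfin⟩
  obtain ⟨K, hK⟩ := exists_lipschitzOnWith_of_supportsPoincare hμ hP
  obtain ⟨N, hN, hN0, hlip⟩ := hK v k hv hk g hg
  set E : ℕ → Set P := fun n =>
    {x | (n : ℝ≥0∞) < maximalFunction μ p (fun x => (g x : EReal)) x} with hE
  have hEm : ∀ n, MeasurableSet (E n) := fun n =>
    (isOpen_lt_maximalFunction p _ _).measurableSet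
  have hMn : Tendsto (fun n : ℕ => X.qnorm ((E n).indicator fun _ => (n : EReal)))
      atTop (𝓝 0) := by
    have h := (hM _ hgX).comp (tendsto_natCast_atTop_atTop (R := ℝ))
    refine h.congr fun n => ?_
    simp only [Function.comp_apply, ENNReal.ofReal_natCast]
    rfl
  have hEanti : Antitone E := fun m n hmn x hx =>
    lt_of_le_of_lt (by exact_mod_cast hmn)
      (show (n : ℝ≥0∞) < maximalFunction μ p (fun x => (g x : EReal)) x from hx)
  have hg0 := hX _ hgX E (fun n => (hEm n).nullMeasurableSet) hEanti
    (X.measure_iInter_lt_maximalFunction hMn)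
  set a : ℕ → ℝ≥0∞ := fun n => X.qnorm ((E n).indicator fun _ => (n : EReal)) with ha
  set b : ℕ → ℝ≥0∞ := fun n => X.qnorm ((E n).indicator fun x => (g x : EReal)) with hb
  have hbound : ∀ n : ℕ, 1 ≤ n → ∃ f : P → ℝ, (∃ K : ℝ≥0, LipschitzWith K f) ∧
      X.newtonNorm (fun x => ((v x - f x : ℝ) : EReal)) ≤
        ((2 * k.toNNReal : ℝ≥0) : ℝ≥0∞) * a n + X.modulus * (X.modulus * (b n + K * a n) +
          (((1 / ((n : ℝ≥0) + 1) : ℝ≥0)) : ℝ≥0∞) * X.qnorm (fun x => (g x : EReal))) := by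
    intro n hn
    obtain ⟨f₀, hf₀, hf₀eq⟩ := (hlip n).extend_real
    -- As |v| ≤ k, truncating the extension preserves both the Lipschitz constant and the agreement
    -- with `v` off F; it bounds v - f by 2k.
    set f : P → ℝ := fun x => max (-k) (min k (f₀ x)) with hf
    have hflip : LipschitzWith (K * n) f := (hf₀.const_min k).const_max (-k)
    have hfk : ∀ x, |f x| ≤ k := fun x =>
      abs_le.2 ⟨le_max_left _ _, max_le (by linarith) (min_le_left _ _)⟩
    -- `N` cannot be discarded: curves see null sets, so localization needs v - f = 0 at every point
    -- off F.
    set F : Set P := E n ∪ N with hF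
    have hFm : MeasurableSet F := (hEm n).union hN
    have hFE : F =ᵐ[μ] E n := union_ae_eq_left_of_ae_eq_empty (ae_eq_empty.2 hN0)
    have hzero : ∀ x ∉ F, v x - f x = 0 := by
      intro x hx
      have h1 : v x = f₀ x := hf₀eq (by simpa [hF, hE] using hx)
      have h2 := abs_le.1 (hk x)
      rw [hf]
      simp only [← h1]
      rw [min_eq_right h2.2, max_eq_right h2.1, sub_self]
    have hfm : Measurable f := hflip.continuous.measurable
    have hwm : AEMeasurable (fun x => v x - f x) μ := hv.sub hfm.aemeasurable
    have hw : IsUpperGradient (fun x => g x + (K * n : ℝ≥0))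
        (fun x => ((v x - f x : ℝ) : EReal)) := by
      have h := hg.add (IsUpperGradient.of_lipschitzWith hflip.neg)
      simpa only [← EReal.coe_add, sub_eq_add_neg, Pi.neg_apply] using h
    have hnind : ∀ c : ℝ≥0, X.qnorm (fun x => ((F.indicator (fun _ => (c * n : ℝ≥0∞)) x : ℝ≥0∞)
        : EReal)) = c * a n := by
      intro c
      have h1 : (fun x => ((F.indicator (fun _ => (n : ℝ≥0∞)) x : ℝ≥0∞) : EReal)) =
          F.indicator fun _ => (n : EReal) := by
        funext x
        by_cases hx : x ∈ F
        · simp [Set.indicator_of_mem hx, coe_ennreal_natCast]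
        · simp [Set.indicator_of_notMem hx]
      rw [ha]
      simp only
      rw [← X.qnorm_indicator_congr hFE hFm.nullMeasurableSet aemeasurable_const, ← h1,
        ← X.qnorm_coe_const_mul c (measurable_const.indicator hFm).aemeasurable]
      refine congrArg _ (funext fun x => ?_)
      by_cases hx : x ∈ F
      · simp [Set.indicator_of_mem hx]
      · simp [Set.indicator_of_notMem hx]
    have hgind : X.qnorm (fun x => ((F.indicator g x : ℝ≥0∞) : EReal)) = b n := by
      rw [hb]
      simp only
      rw [← X.qnorm_indicator_congr hFE hFm.nullMeasurableSet hgX.1]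
      refine congrArg _ (funext fun x => ?_)
      by_cases hx : x ∈ F
      · simp [Set.indicator_of_mem hx]
      · simp [Set.indicator_of_notMem hx]
    refine ⟨f, ⟨_, hflip⟩, ?_⟩
    refine (X.newtonNorm_le_indicator hg.1 hw hFm (fun x hx => by rw [hzero x hx]; rfl)
      (δ := 1 / ((n : ℝ≥0) + 1)) (by positivity)).trans ?_
    gcongr ?_ + _ * (?_ + _)
    -- Since n ≥ 1, the bound 2k on F is at most 2kn, which the maximal function hypothesis
    -- controls.
    · rw [← hnind]
      refine X.qnorm_le_of_ae_le hwm.coe_real_ereal (measurable_const.indicator hFm).aemeasurable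
        (Eventually.of_forall fun x => ?_)
      by_cases hx : x ∈ F
      · rw [Set.indicator_of_mem hx, EReal.abs_def]
        have h1 : |v x - f x| ≤ 2 * k := (abs_sub _ _).trans (by linarith [hk x, hfk x])
        calc ENNReal.ofReal |v x - f x| ≤ ENNReal.ofReal (2 * k) := ENNReal.ofReal_le_ofReal h1
          _ = ((2 * k.toNNReal : ℝ≥0) : ℝ≥0∞) * 1 := by
            rw [ENNReal.ofReal_mul zero_le_two]
            simp [ENNReal.ofReal]
          _ ≤ _ := by gcongr; exact_mod_cast hn
      · rw [hzero x hx]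
        simp
    · rw [← hgind, ← hnind K]
      refine le_trans (le_of_eq ?_) (X.qnorm_coe_add_le (hg.1.indicator hFm).aemeasurable
        (measurable_const.indicator hFm).aemeasurable)
      refine congrArg _ (funext fun x => ?_)
      by_cases hx : x ∈ F
      · simp [Set.indicator_of_mem hx]
      · simp [Set.indicator_of_notMem hx]
  have hlim : Tendsto (fun n : ℕ => ((2 * k.toNNReal : ℝ≥0) : ℝ≥0∞) * a n +
      X.modulus * (X.modulus * (b n + K * a n) +
        (((1 / ((n : ℝ≥0) + 1) : ℝ≥0)) : ℝ≥0∞) * X.qnorm (fun x => (g x : EReal))))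
      atTop (𝓝 0) := by
    have hmul : ∀ (c : ℝ≥0) {s : ℕ → ℝ≥0∞}, Tendsto s atTop (𝓝 0) →
        Tendsto (fun n => (c : ℝ≥0∞) * s n) atTop (𝓝 0) := fun c s hs => by
      simpa using ENNReal.Tendsto.const_mul hs (Or.inr (ENNReal.coe_ne_top (r := c)))
    have hadd : ∀ {s t : ℕ → ℝ≥0∞}, Tendsto s atTop (𝓝 0) → Tendsto t atTop (𝓝 0) →
        Tendsto (fun n => s n + t n) atTop (𝓝 0) := fun hs ht => by simpa using hs.add ht
    exact hadd (hmul _ hMn) (hmul _ (hadd (hmul _ (hadd hg0 (hmul _ hMn)))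
      (tendsto_inv_succ_mul hgX.2.ne)))
  obtain ⟨n, hnε, hn⟩ := ((hlim.eventually_lt_const hε).and (eventually_ge_atTop 1)).exists
  obtain ⟨f, hf, hle⟩ := hbound n hn
  exact ⟨f, hf, hle.trans_lt hnε⟩

end QuasiBanachFunctionLattice

/-! ### Combination of the two approximations -/

theorem mainTheorem1 {P : Type*} [MetricSpace P] [MeasurableSpace P] [BorelSpace P]
    (μ : Measure P) (hμ : IsDoublingMetricMeasure μ)
    (p : ℝ) (hp : 1 ≤ p) (hP : SupportsPoincare μ p)
    (X : QuasiBanachFunctionLattice μ) (hX : X.AbsolutelyContinuous)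
    (hM : ∀ v : P → EReal, X.Mem v →
      Tendsto (fun σ : ℝ => X.qnorm
        ({x | ENNReal.ofReal σ < maximalFunction μ p v x}.indicator (fun _ => (σ : EReal))))
        atTop (𝓝 0)) :
    ∀ u : P → EReal, X.MemNewton u → ∀ ε : ℝ≥0∞, 0 < ε →
      ∃ f : P → ℝ, (∃ K : ℝ≥0, LipschitzWith K f) ∧
        X.MemNewton (fun x => (f x : EReal)) ∧
        X.newtonNorm (fun x => u x - (f x : EReal)) < ε := by
  intro u hu ε hε
  obtain ⟨η, hη, hη1, hηε⟩ : ∃ η : ℝ≥0∞, 0 < η ∧ η < ∞ ∧ X.modulus * (η + η) < ε := by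
    have hlim : Tendsto (fun η : ℝ≥0∞ => X.modulus * (η + η)) (𝓝[>] 0) (𝓝 0) := by
      have h : Tendsto (fun η : ℝ≥0∞ => η) (𝓝[>] 0) (𝓝 0) := tendsto_id.mono_left nhdsWithin_le_nhds
      simpa using ENNReal.Tendsto.const_mul (h.add h)
        (Or.inr (ENNReal.coe_ne_top (r := X.modulus)))
    have h1 : ∀ᶠ η : ℝ≥0∞ in 𝓝[>] 0, η < ∞ :=
      nhdsWithin_le_nhds (Iio_mem_nhds ENNReal.zero_lt_top)
    obtain ⟨η, h2, h3, h4⟩ := ((hlim.eventually_lt_const hε).and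
      (h1.and self_mem_nhdsWithin)).exists
    exact ⟨η, h4, h3, h2⟩
  obtain ⟨n, hn⟩ := ((X.tendsto_newtonNorm_sub_truncate hX hu).eventually_lt_const hη).exists
  set v : P → ℝ := fun x => EReal.truncate n (u x) with hvdef
  have hv : AEMeasurable v μ := EReal.measurable_truncate.comp_aemeasurable hu.1
  have hvN : X.newtonNorm (fun x => (v x : EReal)) < ∞ := by
    obtain ⟨g, hg, hgfin⟩ := X.newtonNorm_lt_iff.1 hu.2
    refine X.newtonNorm_lt_iff.2 ⟨g, hg.mono hg.1 (fun _ => le_rfl)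
      fun x y => EReal.abs_truncate_sub_le _ _, lt_of_le_of_lt ?_ hgfin⟩
    gcongr
    exact X.qnorm_mono _ _ hv.coe_real_ereal hu.1
      (Eventually.of_forall fun x => EReal.abs_truncate_le_abs (Nat.cast_nonneg n) _)
  obtain ⟨f, ⟨K, hf⟩, hfη⟩ := X.exists_lipschitzWith_newtonNorm_sub_lt hμ hP hX hM hv
    (Nat.cast_nonneg n) (fun x => EReal.abs_truncate_le (Nat.cast_nonneg n) _) hvN hη
  have hfm : AEMeasurable f μ := hf.continuous.measurable.aemeasurable
  have hvf : AEMeasurable (fun x => v x - f x) μ := hv.sub hfm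
  refine ⟨f, ⟨K, hf⟩, ⟨hfm.coe_real_ereal, ?_⟩, ?_⟩
  -- Here f = v + (-(v - f)), a sum of two functions of finite Newtonian norm.
  · obtain ⟨a, ha, ha'⟩ := exists_between hvN
    have h := X.newtonNorm_add_le hv.coe_real_ereal hvf.neg ha
      ((X.newtonNorm_neg_le hvf).trans_lt hfη)
    simp only [← EReal.coe_add, Pi.neg_apply, neg_sub, add_sub_cancel] at h
    exact h.trans_lt (ENNReal.mul_lt_top ENNReal.coe_lt_top (ENNReal.add_lt_top.2 ⟨ha', hη1⟩))
  -- Here u - f = (u - v) + (v - f), which is legitimate where u is infinite because v and f are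
  -- real-valued.
  · have h := X.newtonNorm_add_le (EReal.measurable_sub_truncate.comp_aemeasurable hu.1) hvf hn hfη
    refine lt_of_le_of_lt (le_of_eq_of_le (congrArg _ (funext fun x => ?_)) h) hηε
    simp only [Function.comp_apply]
    rw [sub_eq_add_neg, sub_eq_add_neg (u x), add_assoc, ← EReal.coe_neg, ← EReal.coe_neg,
      ← EReal.coe_add]
    congr 2
    ring
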